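/- **Theorem (Legendre's theorem in $I\Delta_0+\Omega_1$).** Work in the language $\{0,1,+,\cdot,\le\}$. Let $I\Delta_0$ be the theory consisting of $PA^-$ (the axioms of the non-negative part of a discretely ordered commutative ring) together with the induction axioms for all $\Delta_0$-formulas, i.e. formulas (with parameters) in which every quantifier is bounded by a term of the language; and let $\Omega_1$ be the axiom $\forall x\,\forall y\ge 1\,\exists z\ (z=x^{\lfloor\log_2 y\rfloor})$. Let $\mathcal M$ be a model of $I\Delta_0+\Omega_1$, taken together with the negatives of its elements; that is, $\mathcal M$ is an ordered commutative ring whose non-negative part $\{x\in\mathcal M : x\ge 0\}$ is a model of $I\Delta_0+\Omega_1$. Let $a,b,c\in\mathcal M$ be non-zero, not all of the same sign, square-free (if $x^2$ divides the element, then $x$ is a unit) and pairwise relatively prime (every common divisor of two of them is a unit). Then there is $(x,y,z)\in\mathcal M^3$, $(x,y,z)\neq(0,0,0)$, with $$ax^2+by^2+cz^2=0$$ if and only if all of the following hold: 1. $-ab$ is a square modulo $c$, 2. $-bc$ is a square modulo $a$, 3. $-ac$ is a square modulo $b$, where $u$ is a square modulo $v$ if there is $w\in\mathcal M$ such that $v$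 divides $u-w^2$ in $\mathcal M$. -/

import Mathlib

open FirstOrder FirstOrder.Language

/-! ### The language `{0, 1, +, ·, ≤}` of arithmetic -/

/-- Function symbols of the language of arithmetic. -/
inductive ArithFunc : ℕ → Type
  | zero : ArithFunc 0
  | one : ArithFunc 0
  | add : ArithFunc 2
  | mul : ArithFunc 2

/-- Relation symbols of the language of arithmetic. -/
inductive ArithRel : ℕ → Type
  | le : ArithRel 2

/-- The first-order language of arithmetic, with symbols `0, 1, +, ·, ≤`. -/
def LArith : Language where
  Functions := ArithFunc
  Relations := ArithRel

namespace LArith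

instance : LArith.IsOrdered := ⟨ArithRel.le⟩

instance (α : Type*) : Zero (LArith.Term α) := ⟨Constants.term (L := LArith) ArithFunc.zero⟩

instance (α : Type*) : One (LArith.Term α) := ⟨Constants.term (L := LArith) ArithFunc.one⟩

instance (α : Type*) : Add (LArith.Term α) := ⟨Functions.apply₂ (L := LArith) ArithFunc.add⟩

instance (α : Type*) : Mul (LArith.Term α) := ⟨Functions.apply₂ (L := LArith) ArithFunc.mul⟩

/-- The natural interpretation of the language of arithmetic in a type with the corresponding
operations and relation. -/
instance structureOfOps (M : Type*) [Zero M] [One M] [Add M] [Mul M] [LE M] :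
    LArith.Structure M where
  funMap
    | .zero, _ => 0
    | .one, _ => 1
    | .add, v => v 0 + v 1
    | .mul, v => v 0 * v 1
  RelMap
    | .le, v => v 0 ≤ v 1

/-- Regard a term with quantifiable variables `&0, …, &(n-1)` as a term with quantifiable
variables `&0, …, &n`, in which `&n` does not occur. -/
def up {α : Type*} {n : ℕ} (t : LArith.Term (α ⊕ Fin n)) : LArith.Term (α ⊕ Fin (n + 1)) :=
  t.relabel (Sum.map id Fin.castSucc)

/-- The innermost quantifiable variable `&n`. -/
def last {α : Type*} {n : ℕ} : LArith.Term (α ⊕ Fin (n + 1)) :=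
  Term.var (Sum.inr (Fin.last n))

/-! ### Bounded formulas -/

/-- The `Δ₀`-formulas: all quantifiers are bounded by terms, i.e. of the form `∀ y ≤ t` or
`∃ y ≤ t`, where `y` does not occur in the term `t`.  (In Mathlib every formula is built from
`⊥`, atomic formulas, `→` and `∀`; negation, conjunction, disjunction are abbreviations.) -/
inductive IsDelta0 {α : Type} : {n : ℕ} → LArith.BoundedFormula α n → Prop
  | falsum {n : ℕ} : IsDelta0 (⊥ : LArith.BoundedFormula α n)
  | equal {n : ℕ} (s t : LArith.Term (α ⊕ Fin n)) : IsDelta0 (s =' t)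
  | le {n : ℕ} (s t : LArith.Term (α ⊕ Fin n)) : IsDelta0 (s.le t)
  | imp {n : ℕ} {φ ψ : LArith.BoundedFormula α n} (hφ : IsDelta0 φ) (hψ : IsDelta0 ψ) :
      IsDelta0 (φ ⟹ ψ)
  | ballLE {n : ℕ} (t : LArith.Term (α ⊕ Fin n)) {φ : LArith.BoundedFormula α (n + 1)}
      (hφ : IsDelta0 φ) : IsDelta0 (∀' ((last.le (up t)) ⟹ φ))
  | bexLE {n : ℕ} (t : LArith.Term (α ⊕ Fin n)) {φ : LArith.BoundedFormula α (n + 1)}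
      (hφ : IsDelta0 φ) : IsDelta0 (∃' ((last.le (up t)) ⊓ φ))

/-! ### The theory `IΔ₀` -/

/-- The basic axioms `PA⁻`: the axioms of the non-negative part of a discretely ordered
commutative ring. -/
def PAminus : LArith.Theory :=
  { ∀' ∀' ∀' (((&0 + &1) + &2) =' (&0 + (&1 + &2))),
    ∀' ∀' ((&0 + &1) =' (&1 + &0)),
    ∀' ∀' ∀' (((&0 * &1) * &2) =' (&0 * (&1 * &2))),
    ∀' ∀' ((&0 * &1) =' (&1 * &0)),
    ∀' ∀' ∀' ((&0 * (&1 + &2)) =' ((&0 * &1) + (&0 * &2))),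
    ∀' ((&0 + 0) =' &0),
    ∀' ((&0 * 0) =' 0),
    ∀' ((&0 * 1) =' &0),
    ∀' ((&0).le &0),
    ∀' ∀' ∀' ((&0).le &1 ⟹ (&1).le &2 ⟹ (&0).le &2),
    ∀' ∀' ((&0).le &1 ⟹ (&1).le &0 ⟹ (&0) =' &1),
    ∀' ∀' ((&0).le &1 ⊔ (&1).le &0),
    ∀' ∀' ∀' ((&0).lt &1 ⟹ Term.lt (&0 + &2) (&1 + &2)),
    ∀' ∀' ∀' ((&0).le &1 ⟹ Term.le (&0 * &2) (&1 * &2)),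
    ∀' ∀' ((&0).le &1 ⟹ ∃' ((&0 + &2) =' &1)),
    ∀' (Term.le 0 &0),
    (Term.lt 0 1 : LArith.BoundedFormula Empty 0),
    ∀' ((Term.lt 0 &0) ⟹ (Term.le 1 &0)) }

/-- The induction axiom for a formula `φ(p, x)`, where `p = (p₀, …, pₙ₋₁)` are parameters and `x`
is the induction variable:
`∀ p, φ(p, 0) → (∀ x, φ(p, x) → φ(p, x + 1)) → ∀ x, φ(p, x)`. -/
noncomputable def inductionAxiom {n : ℕ} (φ : LArith.Formula (Fin n ⊕ Unit)) : LArith.Sentence :=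
  let atZero : LArith.Formula (Fin n) := φ.subst (Sum.elim Term.var fun _ => 0)
  let atSucc : LArith.Formula (Fin n ⊕ Unit) :=
    φ.subst (Sum.elim (fun i => Term.var (Sum.inl i)) fun _ => Term.var (Sum.inr ()) + 1)
  let body : LArith.Formula (Fin n) :=
    atZero ⟹ (Formula.iAlls Unit (φ ⟹ atSucc)) ⟹ Formula.iAlls Unit φ
  Formula.iAlls (Fin n) (body.relabel (Sum.inr : Fin n → Empty ⊕ Fin n))

/-- The theory `IΔ₀`: `PA⁻` together with induction for all `Δ₀`-formulas. -/
def IDelta0 : LArith.Theory :=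
  PAminus ∪ {σ | ∃ (n : ℕ) (φ : LArith.Formula (Fin n ⊕ Unit)), IsDelta0 φ ∧ σ = inductionAxiom φ}

/-! ### Exponentiation and the axiom `Ω₁` -/

/-- The graph `r = β(c, d, i)` of Gödel's `β`-function: `r` is the remainder of `c` on division by
`1 + (i + 1) * d`. -/
def betaGraph {α : Type*} {n : ℕ} (c d i r : LArith.Term (α ⊕ Fin n)) :
    LArith.BoundedFormula α n :=
  (r.lt (1 + (i + 1) * d)) ⊓ ∃' (up c =' (last * up (1 + (i + 1) * d) + up r))

/-- The graph `z = x ^ l` of exponentiation: some pair `(c, d)` codes a sequence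
`w₀, …, w_l` with `w₀ = 1`, `w_(i+1) = w_i * x` for `i < l`, and `w_l = z`. -/
def powGraph {α : Type*} {n : ℕ} (x l z : LArith.Term (α ⊕ Fin n)) : LArith.BoundedFormula α n :=
  -- the two outer quantifiers bind `c` and `d`
  ∃' ∃' (betaGraph (up last) last 0 1 ⊓
    -- `∀ i < l, ∃ w, w = β(c, d, i) ∧ w * x = β(c, d, i + 1)`
    (∀' (last.lt (up (up (up l))) ⟹
      ∃' (betaGraph (up (up (up last))) (up (up last)) (up last) last ⊓
        betaGraph (up (up (up last))) (up (up last)) (up last + 1)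
          (last * up (up (up (up x))))))) ⊓
    betaGraph (up last) last (up (up l)) (up (up z)))

/-- The axiom `Ω₁`, stating that `x ^ ⌊log₂ y⌋` exists for all `x` and all `y ≥ 1`: there are
`l`, `u` and `z` with `u = 2 ^ l`, `u ≤ y < 2 * u` (that is, `l = ⌊log₂ y⌋`) and `z = x ^ l`. -/
def omega1 : LArith.Sentence :=
  ∀' ∀' (Term.le 1 &1 ⟹ ∃' ∃' ∃'
    (powGraph (1 + 1) (&2) (&3) ⊓ (&3).le &1 ⊓ (&1).lt (&3 + &3) ⊓ powGraph (&0) (&2) (&4)))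

/-- The theory `IΔ₀ + Ω₁`. -/
def IDelta0Omega1 : LArith.Theory := IDelta0 ∪ {omega1}

/-- `a` is a square modulo `b`: `a ≡ x²` modulo `b` for some `x`. -/
def IsSquareMod {M : Type*} [CommRing M] (a b : M) : Prop := ∃ x : M, b ∣ a - x ^ 2

end LArith

/-!
# Legendre's theorem in models of bounded arithmetic

The only consequence of `Δ₀`-induction that is used is a least number principle
(`LArith.exists_min_eval`): a polynomial that is non-negative on the set where another polynomial
is non-negative attains its minimum there, as long as its sublevel sets are bounded. It gives
division with remainder and Bézout's theorem (`LArith.isBezout`), and with them the necessity of the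
congruence conditions, by divisibility arguments in a primitive zero.

Sufficiency rests on the geometry of numbers, with no pigeonhole principle and no descent on the
coefficients. Let `a, b > 0 > c`. By the Chinese remainder theorem the congruence conditions define
a lattice of determinant `a b |c|` on which the form `f = a x² + b y² + c z²` is divisible by
`a b c`. The form `g = a x² + b y² + 2 |c| z²` has determinant `2 (a b |c|)³` on this lattice.
A basis of fixed determinant for which the sum of the three values of `g` is least exists
by the least number principle, since `g` bounds the coordinates. Such a basis is reduced, and for
reduced bases the product of the three values is less than four times the determinant
(`LArith.mul_lt_four_mul_det`). Hence `g < 2 a b |c|` at some nonzero lattice vector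
(`LArith.exists_lattice_value_lt`), which gives `-a b |c| < f < 2 a b |c|` there. So `f` is
`0` or `a b |c|`. In the first case this is a zero. In the second case
`(x z + b y, y z - a x, z² + a b)` is one, by an identity.

All minimisations range over tuples bounded by polynomials in the given elements, and this is what
makes the statements to which induction is applied `Δ₀`.
-/

namespace LArith

/-! ### Semantics of terms and `Δ₀`-formulas -/

section Semantics

variable {N : Type*} [Zero N] [One N] [Add N] [Mul N] [LE N] {α : Type*}

instance : LArith.OrderedStructure N := ⟨fun _ => Iff.rfl⟩

@[simp] theorem realize_zero (v : α → N) : (0 : LArith.Term α).realize v = 0 := rfl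

@[simp] theorem realize_one (v : α → N) : (1 : LArith.Term α).realize v = 1 := rfl

@[simp] theorem realize_add (s t : LArith.Term α) (v : α → N) :
    (s + t).realize v = s.realize v + t.realize v := rfl

@[simp] theorem realize_mul (s t : LArith.Term α) (v : α → N) :
    (s * t).realize v = s.realize v * t.realize v := rfl

@[simp] theorem realize_up {n : ℕ} (t : LArith.Term (α ⊕ Fin n)) (v : α → N) (xs : Fin n → N)
    (y : N) : (up t).realize (Sum.elim v (Fin.snoc xs y)) = t.realize (Sum.elim v xs) := by
  rw [up, Term.realize_relabel]
  congr 1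
  funext i
  cases i <;> simp

@[simp] theorem realize_last {n : ℕ} (v : α → N) (xs : Fin n → N) (y : N) :
    (last : LArith.Term (α ⊕ Fin (n + 1))).realize (Sum.elim v (Fin.snoc xs y)) = y := by
  simp [last]

end Semantics

theorem IsDelta0.not {α : Type} {n : ℕ} {φ : LArith.BoundedFormula α n} (h : IsDelta0 φ) :
    IsDelta0 ∼φ :=
  h.imp .falsum

theorem IsDelta0.inf {α : Type} {n : ℕ} {φ ψ : LArith.BoundedFormula α n} (hφ : IsDelta0 φ)
    (hψ : IsDelta0 ψ) : IsDelta0 (φ ⊓ ψ) :=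
  (hφ.imp hψ.not).not

/-- All the quantifiable variables of a `Δ₀`-formula can be quantified existentially, with the free
variable `b` as a common bound. -/
theorem IsDelta0.exists_bounded {N : Type*} [Zero N] [One N] [Add N] [Mul N] [LE N] {α : Type}
    (b : α) {k : ℕ} {φ : LArith.BoundedFormula α k} (hφ : IsDelta0 φ) :
    ∃ ψ : LArith.Formula α, IsDelta0 ψ ∧ ∀ v : α → N,
      ψ.Realize v ↔ ∃ xs : Fin k → N, (∀ i, xs i ≤ v b) ∧ φ.Realize v xs := by
  induction k with
  | zero =>
    refine ⟨φ, hφ, fun v => ⟨fun h => ⟨default, fun i => i.elim0, h⟩, ?_⟩⟩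
    rintro ⟨xs, -, h⟩
    rwa [Subsingleton.elim xs default] at h
  | succ k ih =>
    obtain ⟨ψ, hψ, h⟩ := ih (hφ.bexLE (Term.var (Sum.inl b)))
    refine ⟨ψ, hψ, fun v => (h v).trans ⟨?_, ?_⟩⟩
    · rintro ⟨xs, hxs, hx⟩
      simp only [BoundedFormula.realize_ex, BoundedFormula.realize_inf, Term.realize_le,
        realize_last, realize_up, Term.realize_var, Sum.elim_inl] at hx
      obtain ⟨y, hy, hφy⟩ := hx
      refine ⟨Fin.snoc xs y, fun i => ?_, hφy⟩
      refine Fin.lastCases ?_ (fun j => ?_) i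
      · simpa using hy
      · simpa using hxs j
    · rintro ⟨xs, hxs, hx⟩
      refine ⟨Fin.init xs, fun i => hxs _, ?_⟩
      simp only [BoundedFormula.realize_ex, BoundedFormula.realize_inf, Term.realize_le,
        realize_last, realize_up, Term.realize_var, Sum.elim_inl]
      exact ⟨xs (Fin.last k), hxs _, by rwa [Fin.snoc_init_self]⟩

/-- The induction schema of `IΔ₀`, in semantic form. -/
theorem IDelta0.induction {N : Type*} [Zero N] [One N] [Add N] [Mul N] [LE N]
    (hN : N ⊨ IDelta0) {n : ℕ} {φ : LArith.Formula (Fin n ⊕ Unit)} (hφ : IsDelta0 φ)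
    (d : Fin n → N) (h0 : φ.Realize (Sum.elim d fun _ => 0))
    (hs : ∀ m, φ.Realize (Sum.elim d fun _ => m) → φ.Realize (Sum.elim d fun _ => m + 1)) (m : N) :
    φ.Realize (Sum.elim d fun _ => m) := by
  have h : N ⊨ inductionAxiom φ := hN.realize_of_mem _ (Or.inr ⟨n, φ, hφ, rfl⟩)
  rw [inductionAxiom, Sentence.Realize, Formula.realize_iAlls] at h
  have h := h d
  rw [Formula.realize_relabel] at h
  simp only [Formula.realize_imp, Formula.realize_iAlls] at h
  have e : ∀ {β : Type} (tf : Fin n ⊕ Unit → LArith.Term β) (v : β → N),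
      Formula.Realize (BoundedFormula.subst φ tf) v ↔
        φ.Realize (fun a => (tf a).realize v) := fun tf v => BoundedFormula.realize_subst
  rw [e] at h
  refine h ?_ ?_ fun _ => m
  · convert h0 using 1
    funext a
    rcases a with a | a <;> rfl
  · intro i hi
    rw [e]
    convert hs (i ()) hi using 1
    funext a
    rcases a with a | a <;> rfl

/-! ### The least value of a polynomial -/

section Minimum

variable {M : Type*} [CommRing M] [LinearOrder M] [IsStrictOrderedRing M]

theorem one_le_of_pos (hM : {x : M // 0 ≤ x} ⊨ IDelta0) {x : M} (hx : 0 < x) : 1 ≤ x := by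
  have h : {x : M // 0 ≤ x} ⊨ ((∀' ((Term.lt 0 &0) ⟹ (Term.le 1 &0))) : LArith.Sentence) :=
    hM.realize_of_mem _ (Or.inl (by simp [PAminus]))
  simp only [Sentence.Realize, Formula.Realize, BoundedFormula.realize_all,
    BoundedFormula.realize_imp, Term.realize_le, Term.realize_lt] at h
  simpa [Fin.snoc, ← Subtype.coe_le_coe] using
    h ⟨x, hx.le⟩ (by simpa [Fin.snoc, ← Subtype.coe_lt_coe] using hx)

/-- On tuples of non-negative elements, a polynomial over `M` is a difference of two terms of the
language of arithmetic with non-negative parameters. -/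
theorem exists_terms_eval {k : ℕ} (p : MvPolynomial (Fin k) M) :
    ∃ (n : ℕ) (d : Fin n → {x : M // 0 ≤ x}) (s t : LArith.Term (Fin n ⊕ Fin k)),
      ∀ x : Fin k → {x : M // 0 ≤ x}, MvPolynomial.eval (fun i => (x i : M)) p =
        s.realize (Sum.elim d x) - t.realize (Sum.elim d x) := by
  induction p using MvPolynomial.induction_on with
  | C a =>
    refine ⟨2, ![⟨a ⊔ 0, le_sup_right⟩, ⟨-a ⊔ 0, le_sup_right⟩], Term.var (Sum.inl 0),
      Term.var (Sum.inl 1), fun x => ?_⟩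
    rcases le_total a 0 with h | h <;> simp [h]
  | add p q hp hq =>
    obtain ⟨m, d, s, t, h⟩ := hp
    obtain ⟨n, e, u, v, h'⟩ := hq
    let f : Fin m ⊕ Fin k → Fin (m + n) ⊕ Fin k := Sum.map (Fin.castAdd n) id
    let g : Fin n ⊕ Fin k → Fin (m + n) ⊕ Fin k := Sum.map (Fin.natAdd m) id
    refine ⟨m + n, Fin.append d e, s.relabel f + u.relabel g, t.relabel f + v.relabel g,
      fun x => ?_⟩
    have hf : Sum.elim (Fin.append d e) x ∘ f = Sum.elim d x := by
      funext i; cases i <;> simp [f]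
    have hg : Sum.elim (Fin.append d e) x ∘ g = Sum.elim e x := by
      funext i; cases i <;> simp [g]
    simp only [map_add, h, h', realize_add, Term.realize_relabel, hf, hg, Nonneg.coe_add]
    ring
  | mul_X p i hp =>
    obtain ⟨m, d, s, t, h⟩ := hp
    refine ⟨m, d, s * Term.var (Sum.inr i), t * Term.var (Sum.inr i), fun x => ?_⟩
    simp only [map_mul, h, MvPolynomial.eval_X, realize_mul, Term.realize_var, Sum.elim_inr,
      Nonneg.coe_mul]
    ring

/-- Least number principle: if `P` has non-negative values on the set where `D` is non-negative,
this set is nonempty, and the points of it where `P` is at most some attained value have bounded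
coordinates, then `P` has a least value on this set. -/
theorem exists_min_eval_fin (hM : {x : M // 0 ≤ x} ⊨ IDelta0) {k : ℕ}
    (P D : MvPolynomial (Fin k) M) (x₀ : Fin k → M) (B : M) (h₀ : 0 ≤ D.eval x₀)
    (hP : ∀ x : Fin k → M, 0 ≤ D.eval x → 0 ≤ P.eval x)
    (hB : ∀ x : Fin k → M, 0 ≤ D.eval x → P.eval x ≤ P.eval x₀ → ∀ i, |x i| ≤ B) :
    ∃ x : Fin k → M, 0 ≤ D.eval x ∧ ∀ y : Fin k → M, 0 ≤ D.eval y → P.eval x ≤ P.eval y := by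
  by_contra! hmin
  -- Coordinates are shifted by `B`, so that the bounded quantifiers range over `0, …, 2 B`.
  let sh : MvPolynomial (Fin k) M → MvPolynomial (Fin k) M :=
    MvPolynomial.bind₁ fun i => MvPolynomial.X i - MvPolynomial.C B
  have hsh : ∀ (p : MvPolynomial (Fin k) M) (x : Fin k → M),
      (sh p).eval x = p.eval fun i => x i - B := by
    intro p x
    simp only [sh, MvPolynomial.eval, MvPolynomial.eval₂Hom_bind₁]
    simp
  have hB0 : ∀ i : Fin k, 0 ≤ B := fun i => (abs_nonneg _).trans (hB x₀ h₀ le_rfl i)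
  obtain ⟨m, d, s, t, hPst⟩ := exists_terms_eval (sh P)
  obtain ⟨n, e, u, v, hDuv⟩ := exists_terms_eval (sh D)
  let par : Fin (m + n + 1) → {x : M // 0 ≤ x} :=
    Fin.snoc (Fin.append d e) ⟨2 * |B|, by positivity⟩
  let f : Fin m ⊕ Fin k → (Fin (m + n + 1) ⊕ Unit) ⊕ Fin k :=
    Sum.map (fun i => Sum.inl (Fin.castAdd n i).castSucc) id
  let g : Fin n ⊕ Fin k → (Fin (m + n + 1) ⊕ Unit) ⊕ Fin k :=
    Sum.map (fun i => Sum.inl (Fin.natAdd m i).castSucc) id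
  let z : LArith.Term ((Fin (m + n + 1) ⊕ Unit) ⊕ Fin k) := Term.var (Sum.inl (Sum.inr ()))
  have hφ : IsDelta0 (((v.relabel g).le (u.relabel g)) ⊓ ((s.relabel f).le (t.relabel f + z))) :=
    (IsDelta0.le _ _).inf (IsDelta0.le _ _)
  obtain ⟨ψ, hψ, h⟩ := hφ.exists_bounded (N := {x : M // 0 ≤ x}) (Sum.inl (Fin.last _))
  have key : ∀ w : {x : M // 0 ≤ x}, ψ.Realize (Sum.elim par fun _ => w) ↔
      ∃ x : Fin k → M, (∀ i, |x i| ≤ B) ∧ 0 ≤ D.eval x ∧ P.eval x ≤ w := by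
    intro w
    have hf : ∀ x : Fin k → {x : M // 0 ≤ x},
        Sum.elim (Sum.elim par fun _ => w) x ∘ f = Sum.elim d x := by
      intro x; funext i; cases i <;> simp [f, par]
    have hg : ∀ x : Fin k → {x : M // 0 ≤ x},
        Sum.elim (Sum.elim par fun _ => w) x ∘ g = Sum.elim e x := by
      intro x
      funext i
      rcases i with i | i
      · exact (Fin.snoc_castSucc (α := fun _ => {x : M // 0 ≤ x}) _ _ _).trans
          (Fin.append_right d e i)
      · rfl
    have hz : ∀ x : Fin k → {x : M // 0 ≤ x},
        z.realize (Sum.elim (Sum.elim par fun _ => w) x) = w := fun x => rfl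
    rw [h]
    simp only [BoundedFormula.realize_inf, Term.realize_le, Term.realize_relabel, realize_add, hf,
      hg, hz, ← Subtype.coe_le_coe, Nonneg.coe_add, ← sub_le_iff_le_add',
      ← sub_nonneg (b := ((v.realize _ : {x : M // 0 ≤ x}) : M)), ← hPst, ← hDuv, hsh]
    constructor
    · rintro ⟨x, hx, hD, hPx⟩
      refine ⟨fun i => x i - B, fun i => ?_, hD, hPx⟩
      have h1 := hx i
      simp only [par, Sum.elim_inl, Fin.snoc_last, abs_of_nonneg (hB0 i)] at h1
      have h2 := (x i).2
      rw [abs_le]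
      constructor <;> linarith
    · rintro ⟨x, hx, hD, hPx⟩
      refine ⟨fun i => ⟨x i + B, by linarith [(abs_le.1 (hx i)).1]⟩, fun i => ?_, ?_, ?_⟩
      · simp only [par, Sum.elim_inl, Fin.snoc_last, abs_of_nonneg (hB0 i)]
        linarith [(abs_le.1 (hx i)).2]
      · simpa using hD
      · simpa using hPx
  have hind : ∀ w : {x : M // 0 ≤ x}, Formula.Realize (∼ψ) (Sum.elim par fun _ => w) := by
    refine IDelta0.induction hM hψ.not par ?_ ?_
    · rw [Formula.realize_not, key]
      rintro ⟨x, -, hD, hPx⟩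
      obtain ⟨y, hy, hlt⟩ := hmin x hD
      exact absurd (hP y hy) (by simpa using hlt.trans_le hPx)
    · intro w hw
      rw [Formula.realize_not, key] at hw ⊢
      rintro ⟨x, hxB, hD, hPx⟩
      by_cases hx₀ : P.eval x₀ ≤ P.eval x
      · obtain ⟨y, hy, hlt⟩ := hmin x₀ h₀
        refine hw ⟨y, hB y hy hlt.le, hy, ?_⟩
        have h1 := one_le_of_pos hM (sub_pos.2 (hlt.trans_le (hx₀.trans hPx)))
        simp only [Nonneg.coe_add, Nonneg.coe_one] at h1
        linarith
      · obtain ⟨y, hy, hlt⟩ := hmin x hD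
        refine hw ⟨y, hB y hy (hlt.le.trans (not_le.1 hx₀).le), hy, ?_⟩
        have h1 := one_le_of_pos hM (sub_pos.2 (hlt.trans_le hPx))
        simp only [Nonneg.coe_add, Nonneg.coe_one] at h1
        linarith
  refine (Formula.realize_not.1 (hind ⟨P.eval x₀, hP x₀ h₀⟩)) ((key _).2 ⟨x₀, ?_, h₀, le_rfl⟩)
  exact hB x₀ h₀ le_rfl

/-- The least number principle `exists_min_eval_fin` for an arbitrary finite set of variables. -/
theorem exists_min_eval (hM : {x : M // 0 ≤ x} ⊨ IDelta0) {σ : Type*} [Finite σ]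
    (P D : MvPolynomial σ M) (x₀ : σ → M) (B : M) (h₀ : 0 ≤ D.eval x₀)
    (hP : ∀ x : σ → M, 0 ≤ D.eval x → 0 ≤ P.eval x)
    (hB : ∀ x : σ → M, 0 ≤ D.eval x → P.eval x ≤ P.eval x₀ → ∀ i, |x i| ≤ B) :
    ∃ x : σ → M, 0 ≤ D.eval x ∧ ∀ y : σ → M, 0 ≤ D.eval y → P.eval x ≤ P.eval y := by
  obtain ⟨k, ⟨e⟩⟩ := Finite.exists_equiv_fin σ
  have hr : ∀ (p : MvPolynomial σ M) (x : Fin k → M),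
      (MvPolynomial.rename e p).eval x = p.eval (x ∘ e) := fun p x => MvPolynomial.eval_rename _ _ _
  have h' : x₀ ∘ e.symm ∘ e = x₀ := by funext i; simp
  obtain ⟨x, hx, hmin⟩ := exists_min_eval_fin hM (MvPolynomial.rename e P)
    (MvPolynomial.rename e D) (x₀ ∘ e.symm) B (by simpa [hr, Function.comp_assoc] using h₀)
    (fun x hx => by rw [hr] at hx ⊢; exact hP _ hx)
    (fun x hx hle i => by
      rw [hr] at hx hle
      rw [hr, Function.comp_assoc, h'] at hle
      simpa using hB _ hx hle (e.symm i))
  refine ⟨x ∘ e, by rwa [← hr], fun y hy => ?_⟩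
  have := hmin (y ∘ e.symm) (by simpa [hr, Function.comp_assoc] using hy)
  simpa [hr, Function.comp_assoc] using this

end Minimum

section Arithmetic

variable {M : Type*} [CommRing M] [LinearOrder M] [IsStrictOrderedRing M]

/-! ### Division with remainder and Bézout's theorem -/

theorem abs_le_abs_mul_self {a x : M} (ha : 1 ≤ a) : |x| ≤ |a * x| := by
  rw [abs_mul, abs_of_nonneg (zero_le_one.trans ha)]
  exact le_mul_of_one_le_left (abs_nonneg x) ha

theorem abs_le_sq (hM : {x : M // 0 ≤ x} ⊨ IDelta0) (x : M) : |x| ≤ x ^ 2 := by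
  rcases eq_or_ne x 0 with rfl | hx
  · simp
  · rw [← sq_abs]
    nlinarith [one_le_of_pos hM (abs_pos.2 hx)]

/-- Division with remainder: the remainder is the least non-negative value of `a - q * b`. -/
theorem exists_mul_le_lt_add (hM : {x : M // 0 ≤ x} ⊨ IDelta0) (a : M) {b : M} (hb : 0 < b) :
    ∃ q : M, q * b ≤ a ∧ a < q * b + b := by
  have hb1 := one_le_of_pos hM hb
  let P : MvPolynomial Unit M := MvPolynomial.C a - MvPolynomial.X () * MvPolynomial.C b
  have hP : ∀ x : Unit → M, P.eval x = a - x () * b := fun x => by simp [P]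
  obtain ⟨x, hx, hmin⟩ := exists_min_eval hM P P (fun _ => -|a|) (a + |a| * b + |a|)
    (by rw [hP]; nlinarith [abs_nonneg a, neg_abs_le a]) (fun x hx => hx) (fun x hx hle i => by
      rw [hP] at hx hle
      rw [hP] at hle
      refine (abs_le_abs_mul_self hb1).trans ?_
      rw [abs_le, mul_comm b]
      constructor <;> nlinarith [abs_nonneg a, le_abs_self a, neg_abs_le a])
  rw [hP] at hx
  refine ⟨x (), by linarith, ?_⟩
  by_contra! h
  have := hmin (fun _ => x () + 1) (by rw [hP]; linarith)
  rw [hP, hP] at this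
  linarith

/-- The witness `a * x + b * y` is the least positive one; to bound the coefficients, `x` is
minimised too, with lower priority. -/
theorem exists_dvd_dvd_eq_of_pos (hM : {x : M // 0 ≤ x} ⊨ IDelta0) {a b : M} (ha : 0 < a)
    (hb : 0 < b) : ∃ x y : M, a * x + b * y ∣ a ∧ a * x + b * y ∣ b := by
  have hb1 := one_le_of_pos hM hb
  let L : MvPolynomial Bool M :=
    MvPolynomial.C a * MvPolynomial.X true + MvPolynomial.C b * MvPolynomial.X false
  let P : MvPolynomial Bool M :=
    MvPolynomial.C (b ^ 2 + 1) * L + MvPolynomial.X true ^ 2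
  have hD : ∀ x : Bool → M, (L - 1).eval x = a * x true + b * x false - 1 := fun x => by simp [L]
  have hP : ∀ x : Bool → M,
      P.eval x = (b ^ 2 + 1) * (a * x true + b * x false) + x true ^ 2 := fun x => by simp [P, L]
  set N : M := (b ^ 2 + 1) * b with hN
  obtain ⟨p, hp, hmin⟩ := exists_min_eval hM P (L - 1) (fun i => bif i then 0 else 1) (N + a * N)
    (by rw [hD]; simpa using hb1)
    (fun x hx => by rw [hD] at hx; rw [hP]; nlinarith [sq_nonneg (x true), sq_nonneg b])
    (fun x hx hle i => by
      rw [hD] at hx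
      rw [hP, hP] at hle
      simp only [cond_true, cond_false, mul_zero, mul_one, zero_add, ne_eq, OfNat.ofNat_ne_zero,
        not_false_eq_true, zero_pow, add_zero] at hle
      have h0 : 0 ≤ b ^ 2 * (a * x true + b * x false) :=
        mul_nonneg (sq_nonneg b) (by linarith)
      have h1 : |x true| ≤ N := (abs_le_sq hM _).trans (by nlinarith)
      have h2 : a * x true + b * x false ≤ N := by nlinarith [sq_nonneg (x true)]
      have hN0 : 0 ≤ N := (abs_nonneg _).trans h1
      cases i
      · refine (abs_le_abs_mul_self hb1).trans ?_
        have h3 : |a * x true| ≤ a * N := by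
          rw [abs_mul, abs_of_pos ha]
          exact mul_le_mul_of_nonneg_left h1 ha.le
        rw [abs_le] at h3 ⊢
        constructor <;> linarith
      · nlinarith)
  rw [hD] at hp
  set d := a * p true + b * p false with hd
  have hd0 : 0 < d := by linarith
  -- No smaller positive combination exists, since its coefficient of `a` can be reduced modulo `b`.
  have hleast : ∀ x y : M, 0 < a * x + b * y → d ≤ a * x + b * y := by
    intro x y hxy
    obtain ⟨q, hq1, hq2⟩ := exists_mul_le_lt_add hM x hb
    by_contra! hlt
    have e : a * (x - q * b) + b * (y + q * a) = a * x + b * y := by ring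
    have h1 := hmin (fun i => bif i then x - q * b else y + q * a)
      (by rw [hD]; simp only [cond_true, cond_false, e]; linarith [one_le_of_pos hM hxy])
    rw [hP, hP] at h1
    simp only [cond_true, cond_false, e] at h1
    have h2 : a * x + b * y ≤ d - 1 := by linarith [one_le_of_pos hM (sub_pos.2 hlt)]
    have h3 : (x - q * b) ^ 2 ≤ b ^ 2 := by
      apply pow_le_pow_left₀ <;> linarith
    nlinarith [sq_nonneg (p true), mul_le_mul_of_nonneg_left h2 (by positivity : 0 ≤ b ^ 2 + 1)]
  refine ⟨p true, p false, ?_, ?_⟩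
  · obtain ⟨q, hq1, hq2⟩ := exists_mul_le_lt_add hM a hd0
    refine ⟨q, ?_⟩
    by_contra hne
    have e : a * (1 - q * p true) + b * (-q * p false) = a - q * d := by rw [hd]; ring
    have hpos : 0 < a - q * d := (sub_nonneg.2 hq1).lt_of_ne fun h => hne (by rw [← hd]; linarith)
    have := hleast (1 - q * p true) (-q * p false) (by rwa [e])
    rw [e] at this
    linarith
  · obtain ⟨q, hq1, hq2⟩ := exists_mul_le_lt_add hM b hd0
    refine ⟨q, ?_⟩
    by_contra hne
    have e : a * (-q * p true) + b * (1 - q * p false) = b - q * d := by rw [hd]; ring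
    have hpos : 0 < b - q * d := (sub_nonneg.2 hq1).lt_of_ne fun h => hne (by rw [← hd]; linarith)
    have := hleast (-q * p true) (1 - q * p false) (by rwa [e])
    rw [e] at this
    linarith

theorem isBezout (hM : {x : M // 0 ≤ x} ⊨ IDelta0) : IsBezout M := by
  rw [IsBezout.iff_span_pair_isPrincipal]
  intro a b
  rcases eq_or_ne a 0 with rfl | ha
  · exact ⟨b, by simp⟩
  rcases eq_or_ne b 0 with rfl | hb
  · exact ⟨a, by simp [Set.pair_comm]⟩
  obtain ⟨x, y, h1, h2⟩ := exists_dvd_dvd_eq_of_pos hM (abs_pos.2 ha) (abs_pos.2 hb)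
  rw [dvd_abs] at h1 h2
  refine ⟨|a| * x + |b| * y, le_antisymm ?_ ?_⟩
  · rw [Ideal.span_le]
    rintro z (rfl | rfl)
    · exact Ideal.mem_span_singleton.2 h1
    · exact Ideal.mem_span_singleton.2 h2
  · rw [Ideal.submodule_span_eq, Ideal.span_singleton_le_iff_mem]
    refine Ideal.add_mem _ (Ideal.mul_mem_right _ _ ?_) (Ideal.mul_mem_right _ _ ?_)
    · exact Ideal.mem_of_dvd _ (self_dvd_abs a) (Ideal.subset_span (by simp))
    · exact Ideal.mem_of_dvd _ (self_dvd_abs b) (Ideal.subset_span (by simp))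

end Arithmetic

/-! ### Zeros of diagonal ternary forms over Bézout domains -/

section Bezout

variable {R : Type*} [CommRing R]

theorem isSquareMod_neg_mul_of_isCoprime {a b c x y z : R} (hy : IsCoprime y c)
    (h : a * x ^ 2 + b * y ^ 2 + c * z ^ 2 = 0) : IsSquareMod (-(a * b)) c := by
  obtain ⟨u, v, huv⟩ := hy
  refine ⟨a * x * u, a * u ^ 2 * z ^ 2 - a * b * v * (1 + u * y), ?_⟩
  linear_combination (-a * u ^ 2) * h + a * b * (1 + u * y) * huv

variable [IsDomain R] [IsBezout R]

/-- A common divisor `d` of `y` and `c` divides `x`, being squarefree; then `d ^ 2` divides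
`c * z ^ 2`, so that `d` divides `z` as well. -/
theorem isCoprime_of_primitive_zero {a b c x y z : R} (hsc : Squarefree c)
    (hac : IsCoprime a c) (hxyz : ∀ d, d ∣ x → d ∣ y → d ∣ z → IsUnit d)
    (h : a * x ^ 2 + b * y ^ 2 + c * z ^ 2 = 0) : IsCoprime y c := by
  refine IsRelPrime.isCoprime fun d hdy hdc => ?_
  have hsd : Squarefree d := hsc.squarefree_of_dvd hdc
  have hdx : d ∣ x := by
    refine hsd.isRadical 2 x ((hac.of_isCoprime_of_dvd_right hdc).symm.dvd_of_dvd_mul_left ?_)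
    have : a * x ^ 2 = -(b * y * y + c * z ^ 2) := by linear_combination h
    rw [this]
    exact dvd_neg.2 (dvd_add (hdy.mul_left _) (hdc.mul_right _))
  refine hxyz d hdx hdy ?_
  obtain ⟨e, rfl⟩ := hdc
  have hde : IsCoprime d e := (IsRelPrime.of_squarefree_mul hsc).isCoprime
  refine hsd.isRadical 2 z (hde.dvd_of_dvd_mul_left ?_)
  have hd0 : d ≠ 0 := left_ne_zero_of_mul hsc.ne_zero
  obtain ⟨x, rfl⟩ := hdx
  obtain ⟨y, rfl⟩ := hdy
  refine ⟨-(a * x ^ 2 + b * y ^ 2), mul_left_cancel₀ hd0 ?_⟩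
  linear_combination h

/-- A zero divided by a generator of the ideal of its coordinates is primitive. -/
theorem exists_primitive_zero {a b c x y z : R} (hne : (x, y, z) ≠ (0, 0, 0))
    (h : a * x ^ 2 + b * y ^ 2 + c * z ^ 2 = 0) :
    ∃ x y z : R, (∀ d, d ∣ x → d ∣ y → d ∣ z → IsUnit d) ∧
      a * x ^ 2 + b * y ^ 2 + c * z ^ 2 = 0 := by
  obtain ⟨g, hg⟩ := (IsBezout.isPrincipal_of_FG (Ideal.span {x, y, z})
    (Submodule.fg_span (Set.toFinite _))).principal
  rw [Ideal.submodule_span_eq] at hg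
  have hdvd : ∀ w ∈ ({x, y, z} : Set R), g ∣ w := fun w hw =>
    Ideal.mem_span_singleton.1 (hg ▸ Ideal.subset_span hw)
  have hgm : g ∈ Ideal.span {x, y, z} := hg ▸ Ideal.mem_span_singleton_self g
  obtain ⟨u, v, w, huvw⟩ := Submodule.mem_span_triple.1 hgm
  obtain ⟨x', rfl⟩ := hdvd x (by simp)
  obtain ⟨y', rfl⟩ := hdvd y (by simp)
  obtain ⟨z', rfl⟩ := hdvd z (by simp)
  have hg0 : g ≠ 0 := by
    rintro rfl
    simp at hne
  have h1 : u * x' + v * y' + w * z' = 1 := by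
    refine mul_left_cancel₀ hg0 ?_
    simp only [smul_eq_mul] at huvw
    linear_combination huvw
  refine ⟨x', y', z', fun d hx hy hz => ?_, mul_left_cancel₀ (pow_ne_zero 2 hg0) ?_⟩
  · rw [isUnit_iff_dvd_one, ← h1]
    exact dvd_add (dvd_add (hx.mul_left _) (hy.mul_left _)) (hz.mul_left _)
  · linear_combination h

/-- The congruence conditions of Legendre's theorem are necessary: in a primitive zero, each
coordinate is coprime to the other two coefficients. -/
theorem isSquareMod_of_zero {a b c : R} (hsa : Squarefree a) (hsb : Squarefree b)
    (hsc : Squarefree c) (hab : IsCoprime a b) (hac : IsCoprime a c)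
    {x y z : R} (hne : (x, y, z) ≠ (0, 0, 0)) (h : a * x ^ 2 + b * y ^ 2 + c * z ^ 2 = 0) :
    IsSquareMod (-(a * b)) c ∧ IsSquareMod (-(b * c)) a ∧ IsSquareMod (-(a * c)) b := by
  obtain ⟨x, y, z, hp, h⟩ := exists_primitive_zero hne h
  refine ⟨?_, ?_, ?_⟩
  · exact isSquareMod_neg_mul_of_isCoprime (isCoprime_of_primitive_zero hsc hac hp h) h
  · have e : b * y ^ 2 + c * z ^ 2 + a * x ^ 2 = 0 := by linear_combination h
    exact isSquareMod_neg_mul_of_isCoprime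
      (isCoprime_of_primitive_zero hsa hab.symm (fun d hy hz hx => hp d hx hy hz) e) e
  · have e : a * x ^ 2 + c * z ^ 2 + b * y ^ 2 = 0 := by linear_combination h
    exact isSquareMod_neg_mul_of_isCoprime
      (isCoprime_of_primitive_zero hsb hab (fun d hx hz hy => hp d hx hy hz) e) e

end Bezout

/-! ### Reduction of positive ternary quadratic forms -/

section Reduction

variable {M : Type*} [CommRing M] [LinearOrder M] [IsStrictOrderedRing M]

/-- The inequality for reduced forms with non-positive off-diagonal entries `-r`, `-s`, `-t`;
here the condition `h` on the sum of the three basis vectors is needed. -/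
theorem mul_lt_four_mul_det_of_nonneg {A B C r s t : M} (hA : 0 < A) (hAB : A ≤ B) (hBC : B ≤ C)
    (hr : 0 ≤ r) (hs : 0 ≤ s) (ht : 0 ≤ t) (hrB : 2 * r ≤ B) (hsA : 2 * s ≤ A) (htA : 2 * t ≤ A)
    (h : 2 * (r + s + t) ≤ A + B) :
    A * B * C < 4 * (A * B * C - 2 * r * s * t - A * r ^ 2 - B * s ^ 2 - C * t ^ 2) := by
  have hB : 0 < B := hA.trans_le hAB
  have hC : 0 < C := hB.trans_le hBC
  have h1 : 4 * (A * r ^ 2) ≤ 2 * (A * C * r) := by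
    nlinarith [mul_nonneg (mul_nonneg hA.le hr) (by linarith : 0 ≤ C - 2 * r)]
  have h2 : 4 * (B * s ^ 2) ≤ 2 * (A * C * s) := by
    nlinarith [mul_nonneg (mul_nonneg hB.le hs) (by linarith : 0 ≤ A - 2 * s),
      mul_nonneg (mul_nonneg hA.le hs) (by linarith : 0 ≤ C - B)]
  have h3 : 4 * (C * t ^ 2) ≤ 2 * (A * C * t) := by
    nlinarith [mul_nonneg (mul_nonneg hC.le ht) (by linarith : 0 ≤ A - 2 * t)]
  have h4 : A * C * (2 * (r + s + t)) ≤ A * C * (2 * B) :=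
    mul_le_mul_of_nonneg_left (by linarith) (by positivity)
  have h5 : (2 * r) * ((2 * s) * (2 * t)) < A * B * C := by
    have hst : (2 * s) * (2 * t) ≤ A * A := by gcongr
    rcases hrB.lt_or_eq with hlt | heq
    · calc (2 * r) * ((2 * s) * (2 * t)) ≤ (2 * r) * (A * A) := by gcongr
        _ < B * (A * A) := by gcongr
        _ ≤ A * B * C := by nlinarith [mul_pos hA hB]
    · have : (2 * s) * (2 * t) < A * A := by nlinarith
      calc (2 * r) * ((2 * s) * (2 * t)) = B * ((2 * s) * (2 * t)) := by rw [heq]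
        _ < B * (A * A) := by gcongr
        _ ≤ A * B * C := by nlinarith [mul_pos hA hB]
  linarith

/-- The inequality for reduced forms whose diagonal entries are ordered. -/
theorem mul_lt_four_mul_det_of_le {A B C r s t : M} (hA : 0 < A) (hAB : A ≤ B) (hBC : B ≤ C)
    (hrB : 2 * |r| ≤ B) (hsA : 2 * |s| ≤ A) (htA : 2 * |t| ≤ A)
    (h : r * s * t < 0 → 2 * (|r| + |s| + |t|) ≤ A + B) :
    A * B * C < 4 * (A * B * C + 2 * r * s * t - A * r ^ 2 - B * s ^ 2 - C * t ^ 2) := by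
  rcases lt_or_ge (r * s * t) 0 with hneg | hnn
  · have := mul_lt_four_mul_det_of_nonneg hA hAB hBC (abs_nonneg r) (abs_nonneg s) (abs_nonneg t)
      hrB hsA htA (h hneg)
    have e : |r| * |s| * |t| = -(r * s * t) := by rw [← abs_mul, ← abs_mul, abs_of_neg hneg]
    simp only [sq_abs] at this
    linarith
  · have hB : 0 < B := hA.trans_le hAB
    have hC : 0 < C := hB.trans_le hBC
    have h1 : A * (4 * r ^ 2) ≤ A * (B * C) := by
      rw [← sq_abs r]
      have : (2 * |r|) * (2 * |r|) ≤ B * C := by gcongr; linarith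
      nlinarith
    have h2 : B * (4 * s ^ 2) ≤ B * (A * C) := by
      rw [← sq_abs s]
      have : (2 * |s|) * (2 * |s|) ≤ A * C := by gcongr; linarith
      nlinarith
    have h3 : C * (4 * t ^ 2) ≤ C * (A * B) := by
      rw [← sq_abs t]
      have : (2 * |t|) * (2 * |t|) ≤ A * B := by gcongr; linarith
      nlinarith
    have hABC : 0 < A * B * C := by positivity
    rcases hnn.lt_or_eq with hpos | h0
    · linarith
    · -- One of the off-diagonal entries vanishes, which makes one of the three bounds strict.
      rcases mul_eq_zero.1 h0.symm with h0' | rfl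
      · rcases mul_eq_zero.1 h0' with rfl | rfl <;> linarith
      · linarith

/-- A weak form of Seeber's inequality. The hypotheses say that, for each member of a basis, adding
combinations of the other two members does not decrease the value of the quadratic form with Gram
matrix `!![A, t, s; t, B, r; s, r, C]`. -/
theorem mul_lt_four_mul_det {A B C r s t : M} (hA : 0 < A) (hB : 0 < B) (hC : 0 < C)
    (h0 : ∀ e f : M, 0 ≤ e ^ 2 * B + f ^ 2 * C + 2 * e * t + 2 * f * s + 2 * e * f * r)
    (h1 : ∀ e f : M, 0 ≤ e ^ 2 * A + f ^ 2 * C + 2 * e * t + 2 * f * r + 2 * e * f * s)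
    (h2 : ∀ e f : M, 0 ≤ e ^ 2 * A + f ^ 2 * B + 2 * e * s + 2 * f * r + 2 * e * f * t) :
    A * B * C < 4 * (A * B * C + 2 * r * s * t - A * r ^ 2 - B * s ^ 2 - C * t ^ 2) := by
  have pair : ∀ {X y : M}, 0 ≤ X + 2 * y → 0 ≤ X - 2 * y → 2 * |y| ≤ X := by
    intro X y h h'
    rcases abs_cases y with ⟨e, -⟩ | ⟨e, -⟩ <;> rw [e] <;> linarith
  have tB : 2 * |t| ≤ B := pair (by linarith [h0 1 0]) (by linarith [h0 (-1) 0])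
  have sC : 2 * |s| ≤ C := pair (by linarith [h0 0 1]) (by linarith [h0 0 (-1)])
  have tA : 2 * |t| ≤ A := pair (by linarith [h1 1 0]) (by linarith [h1 (-1) 0])
  have rC : 2 * |r| ≤ C := pair (by linarith [h1 0 1]) (by linarith [h1 0 (-1)])
  have sA : 2 * |s| ≤ A := pair (by linarith [h2 1 0]) (by linarith [h2 (-1) 0])
  have rB : 2 * |r| ≤ B := pair (by linarith [h2 0 1]) (by linarith [h2 0 (-1)])
  have triple : ∀ {X Y u v w : M}, u * v * w < 0 →
      (∀ e f : M, 0 ≤ e ^ 2 * X + f ^ 2 * Y + 2 * e * u + 2 * f * v + 2 * e * f * w) →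
      2 * (|u| + |v| + |w|) ≤ X + Y := by
    intro X Y u v w hneg h
    have e : |u| * |v| * |w| = -(u * v * w) := by rw [← abs_mul, ← abs_mul, abs_of_neg hneg]
    rcases abs_cases u with ⟨hu, hu'⟩ | ⟨hu, hu'⟩ <;>
      rcases abs_cases v with ⟨hv, hv'⟩ | ⟨hv, hv'⟩
    · have hw : w < 0 := by
        by_contra! hw
        exact hneg.not_ge (by positivity)
      rw [hu, hv, abs_of_neg hw]
      linarith [h (-1) (-1)]
    · have hw : 0 ≤ w := by
        by_contra! hw
        exact hneg.not_ge (mul_nonneg_of_nonpos_of_nonpos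
          (mul_nonpos_of_nonneg_of_nonpos hu' hv'.le) hw.le)
      rw [hu, hv, abs_of_nonneg hw]
      linarith [h (-1) 1]
    · have hw : 0 ≤ w := by
        by_contra! hw
        exact hneg.not_ge (mul_nonneg_of_nonpos_of_nonpos
          (mul_nonpos_of_nonpos_of_nonneg hu'.le hv') hw.le)
      rw [hu, hv, abs_of_nonneg hw]
      linarith [h 1 (-1)]
    · have hw : w < 0 := by
        by_contra! hw
        exact hneg.not_ge (mul_nonneg (mul_nonneg_of_nonpos_of_nonpos hu'.le hv'.le) hw)
      rw [hu, hv, abs_of_neg hw]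
      linarith [h 1 1]
  have H : r * s * t < 0 → 2 * (|r| + |s| + |t|) ≤ A + B ∧ 2 * (|r| + |s| + |t|) ≤ A + C ∧
      2 * (|r| + |s| + |t|) ≤ B + C := by
    intro hneg
    have a0 := triple (by linarith) h0
    have a1 := triple (by linarith) h1
    have a2 := triple (by linarith) h2
    exact ⟨by linarith, by linarith, by linarith⟩
  rcases le_total A B with hAB | hAB <;> rcases le_total B C with hBC | hBC
  · linarith [mul_lt_four_mul_det_of_le hA hAB hBC rB sA tA (fun h => (H h).1)]
  · rcases le_total A C with hAC | hAC
    · linarith [mul_lt_four_mul_det_of_le hA hAC hBC rC tA sA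
        (fun h => by linarith [(H (by linarith)).2.1])]
    · linarith [mul_lt_four_mul_det_of_le hC hAC hAB tA rC sC
        (fun h => by linarith [(H (by linarith)).2.1])]
  · rcases le_total A C with hAC | hAC
    · linarith [mul_lt_four_mul_det_of_le hB hAB hAC sA rB tB
        (fun h => by linarith [(H (by linarith)).1])]
    · linarith [mul_lt_four_mul_det_of_le hB hBC hAC sC tB rB
        (fun h => by linarith [(H (by linarith)).2.2])]
  · linarith [mul_lt_four_mul_det_of_le hC hBC hAB tB sC rC
      (fun h => by linarith [(H (by linarith)).2.2])]

/-- A positive definite ternary form over `M` whose sublevel sets are bounded takes a value at a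
nonzero vector of which the cube is less than four times the determinant. -/
theorem exists_value_pow_three_lt (hM : {x : M // 0 ≤ x} ⊨ IDelta0)
    (G : Matrix (Fin 3) (Fin 3) M) (hG : G.IsSymm)
    (hpos : ∀ v : Fin 3 → M, v ≠ 0 → 0 < v ⬝ᵥ G.mulVec v)
    (hB : ∀ N : M, ∃ B : M, ∀ v : Fin 3 → M, v ⬝ᵥ G.mulVec v ≤ N → ∀ i, |v i| ≤ B) :
    ∃ v : Fin 3 → M, v ≠ 0 ∧ (v ⬝ᵥ G.mulVec v) ^ 3 < 4 * G.det := by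
  set Q : (Fin 3 → M) → M := fun v => v ⬝ᵥ G.mulVec v with hQ
  have hQ0 : ∀ v, 0 ≤ Q v := fun v => by
    rcases eq_or_ne v 0 with rfl | hv
    · simp [hQ]
    · exact (hpos v hv).le
  -- Among the bases of `M ^ 3` of determinant `1`, take one with the least sum of values of `Q`.
  let mat : (Fin 3 × Fin 3 → M) → Matrix (Fin 3) (Fin 3) M := fun x => Matrix.of fun i j => x (i, j)
  let X : Matrix (Fin 3) (Fin 3) (MvPolynomial (Fin 3 × Fin 3) M) := Matrix.mvPolynomialX _ _ M
  let P : MvPolynomial (Fin 3 × Fin 3) M := ∑ i, X i ⬝ᵥ (G.map MvPolynomial.C).mulVec (X i)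
  have hP : ∀ x, P.eval x = ∑ i, Q (mat x i) := fun x => by
    simp [P, X, hQ, mat, dotProduct, Matrix.mulVec, Matrix.mvPolynomialX]
  have hD : ∀ x, (-(X.det - 1) ^ 2).eval x = -((mat x).det - 1) ^ 2 := fun x => by
    simp [X, mat, Matrix.det_fin_three, Matrix.mvPolynomialX]
  have hdet : ∀ x, 0 ≤ (-(X.det - 1) ^ 2).eval x ↔ (mat x).det = 1 := fun x => by
    rw [hD, Left.nonneg_neg_iff, sq_nonpos_iff, sub_eq_zero]
  have hmat : ∀ T : Matrix (Fin 3) (Fin 3) M, mat (fun ij => T ij.1 ij.2) = T := fun T => rfl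
  obtain ⟨B, hB⟩ := hB (P.eval fun ij => (1 : Matrix (Fin 3) (Fin 3) M) ij.1 ij.2)
  obtain ⟨x, hx, hmin⟩ := exists_min_eval hM P (-(X.det - 1) ^ 2)
    (fun ij => (1 : Matrix (Fin 3) (Fin 3) M) ij.1 ij.2) B
    (by rw [hdet, hmat, Matrix.det_one])
    (fun x _ => by rw [hP]; exact Finset.sum_nonneg fun i _ => hQ0 _)
    (fun x _ hle i => by
      refine hB (mat x i.1) (le_trans ?_ hle) i.2
      rw [hP x]
      exact Finset.single_le_sum (f := fun i => Q (mat x i)) (fun i _ => hQ0 _)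
        (Finset.mem_univ i.1))
  rw [hdet] at hx
  set T := mat x with hT
  have hmin : ∀ T' : Matrix (Fin 3) (Fin 3) M, T'.det = 1 → ∑ i, Q (T i) ≤ ∑ i, Q (T' i) := by
    intro T' hT'
    have := hmin (fun ij => T' ij.1 ij.2) (by rwa [hdet, hmat])
    rwa [hP, hP, hmat] at this
  set S : Matrix (Fin 3) (Fin 3) M := T * G * T.transpose with hS
  have hSdet : S.det = G.det := by simp [hS, hx]
  have hSsymm : ∀ i j, S i j = S j i := fun i j => by
    have : S.IsSymm := by
      rw [Matrix.IsSymm, hS, Matrix.transpose_mul, Matrix.transpose_mul, Matrix.transpose_transpose,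
        hG.eq, Matrix.mul_assoc]
    exact (this.apply i j).symm
  have hSe : ∀ i j, S i j = T i ⬝ᵥ G.mulVec (T j) := fun i j => by
    rw [hS, Matrix.mul_assoc, Matrix.mul_apply_eq_vecMul]
    simp [Matrix.mul_apply, dotProduct, Matrix.mulVec, Matrix.vecMul]
  have hTne : ∀ i, T i ≠ 0 := fun i h0 => by
    rw [Matrix.det_eq_zero_of_row_eq_zero i fun j => congrFun h0 j] at hx
    exact zero_ne_one hx
  have hSpos : ∀ i, 0 < S i i := fun i => by
    rw [hSe]
    exact hpos _ (hTne i)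
  have hred : ∀ i j k, i ≠ j → i ≠ k → ∀ e f : M,
      0 ≤ e ^ 2 * S j j + f ^ 2 * S k k + 2 * e * S i j + 2 * f * S i k + 2 * e * f * S j k := by
    intro i j k hij hik e f
    have hz : (T.updateRow i (T k)).det = 0 :=
      Matrix.det_zero_of_row_eq hik (by rw [Matrix.updateRow_self, Matrix.updateRow_ne hik.symm])
    have h1 := hmin (T.updateRow i (T i + e • T j + f • T k)) (by
      rw [← hx, Matrix.det_updateRow_add, Matrix.det_updateRow_smul,
        Matrix.det_updateRow_add_smul_self _ hij, hz, mul_zero, add_zero])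
    rw [← Finset.add_sum_erase _ _ (Finset.mem_univ i),
      ← Finset.add_sum_erase _ (fun l => Q (T.updateRow i _ l)) (Finset.mem_univ i)] at h1
    have h2 : ∀ u, ∑ l ∈ Finset.univ.erase i, Q (T.updateRow i u l) =
        ∑ l ∈ Finset.univ.erase i, Q (T l) := fun u =>
      Finset.sum_congr rfl fun l hl => by rw [Matrix.updateRow_ne (Finset.ne_of_mem_erase hl)]
    rw [h2, Matrix.updateRow_self] at h1
    have h3 : Q (T i + e • T j + f • T k) = S i i + e ^ 2 * S j j + f ^ 2 * S k k +
        2 * e * S i j + 2 * f * S i k + 2 * e * f * S j k := by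
      simp only [hQ, Matrix.mulVec_add, Matrix.mulVec_smul, dotProduct_add, add_dotProduct,
        smul_dotProduct, dotProduct_smul, ← hSe, smul_eq_mul, hSsymm j i, hSsymm k i, hSsymm k j]
      ring
    have h4 : Q (T i) = S i i := (hSe i i).symm
    linarith
  have key := mul_lt_four_mul_det (hSpos 0) (hSpos 1) (hSpos 2)
    (hred 0 1 2 (by decide) (by decide))
    (fun e f => by simpa [hSsymm 1 0] using hred 1 0 2 (by decide) (by decide) e f)
    (fun e f => by simpa [hSsymm 2 0, hSsymm 2 1] using hred 2 0 1 (by decide) (by decide) e f)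
  have hdS : S 0 0 * S 1 1 * S 2 2 < 4 * G.det := by
    rw [← hSdet, Matrix.det_fin_three, hSsymm 1 0, hSsymm 2 0, hSsymm 2 1]
    linarith
  obtain ⟨i, -, hi⟩ := Finset.exists_min_image Finset.univ (fun i => S i i) ⟨0, Finset.mem_univ _⟩
  refine ⟨T i, hTne i, lt_of_le_of_lt ?_ hdS⟩
  rw [← hSe, pow_three, ← mul_assoc]
  have h := fun j => hi j (Finset.mem_univ j)
  have h0 := fun j => (hSpos j).le
  exact mul_le_mul (mul_le_mul (h 0) (h 1) (h0 i) (h0 0)) (h 2) (h0 i) (mul_nonneg (h0 0) (h0 1))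

end Reduction

/-! ### Small values of definite forms and zeros of indefinite forms -/

section Legendre

variable {M : Type*} [CommRing M] [LinearOrder M] [IsStrictOrderedRing M]

/-- The form `a * x ^ 2 + b * y ^ 2 + 2 * c * z ^ 2` takes a value below `2 * a * b * c` on the
lattice of determinant `a * b * c` spanned by `(b * c, 0, 0)`, `(l, a, 0)` and `(m, n, 1)`. -/
theorem exists_lattice_value_lt (hM : {x : M // 0 ≤ x} ⊨ IDelta0) {a b c : M} (ha : 0 < a)
    (hb : 0 < b) (hc : 0 < c) (l m n : M) :
    ∃ X Y Z : M, (b * c * X + l * Y + m * Z, a * Y + n * Z, Z) ≠ (0, 0, 0) ∧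
      a * (b * c * X + l * Y + m * Z) ^ 2 + b * (a * Y + n * Z) ^ 2 + 2 * c * Z ^ 2 <
        2 * (a * b * c) := by
  have ha1 := one_le_of_pos hM ha
  have hb1 := one_le_of_pos hM hb
  have hc1 := one_le_of_pos hM hc
  have hbc : 0 < b * c := mul_pos hb hc
  let E : Matrix (Fin 3) (Fin 3) M := !![b * c, 0, 0; l, a, 0; m, n, 1]
  let G : Matrix (Fin 3) (Fin 3) M := E * Matrix.diagonal ![a, b, 2 * c] * E.transpose
  have hG : G.IsSymm := by
    simp only [G, Matrix.IsSymm, Matrix.transpose_mul, Matrix.transpose_transpose,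
      Matrix.diagonal_transpose, Matrix.mul_assoc]
  have hdet : 4 * G.det = (2 * (a * b * c)) ^ 3 := by
    simp only [G, E, Matrix.det_mul, Matrix.det_transpose, Matrix.det_diagonal,
      Matrix.det_fin_three, Fin.prod_univ_three]
    simp
    ring
  have hQ : ∀ v : Fin 3 → M, v ⬝ᵥ G.mulVec v = a * (b * c * v 0 + l * v 1 + m * v 2) ^ 2 +
      b * (a * v 1 + n * v 2) ^ 2 + 2 * c * v 2 ^ 2 := by
    intro v
    simp only [G, ← Matrix.mulVec_mulVec, Matrix.mulVec_transpose, Matrix.dotProduct_mulVec v E]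
    simp [E, dotProduct, Fin.sum_univ_three, Matrix.mulVec_diagonal, Matrix.vecMul,
      Matrix.vecHead, Matrix.vecTail]
    ring
  have hzero : ∀ X Y Z : M, (b * c * X + l * Y + m * Z, a * Y + n * Z, Z) = (0, 0, 0) →
      X = 0 ∧ Y = 0 ∧ Z = 0 := by
    intro X Y Z h
    simp only [Prod.mk.injEq] at h
    obtain ⟨h1, h2, rfl⟩ := h
    have hY : Y = 0 := by simpa [ha.ne'] using h2
    subst hY
    exact ⟨by simpa [hb.ne', hc.ne'] using h1, rfl, rfl⟩
  have hne : ∀ v : Fin 3 → M, v ≠ 0 →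
      (b * c * v 0 + l * v 1 + m * v 2, a * v 1 + n * v 2, v 2) ≠ (0, 0, 0) := by
    intro v hv h
    obtain ⟨h0, h1, h2⟩ := hzero _ _ _ h
    exact hv (funext fun i => by fin_cases i <;> assumption)
  have hpos : ∀ v : Fin 3 → M, v ≠ 0 → 0 < v ⬝ᵥ G.mulVec v := by
    intro v hv
    rw [hQ]
    by_contra! h
    have h1 := mul_nonneg ha.le (sq_nonneg (b * c * v 0 + l * v 1 + m * v 2))
    have h2 := mul_nonneg hb.le (sq_nonneg (a * v 1 + n * v 2))
    have h3 := mul_nonneg (mul_pos two_pos hc).le (sq_nonneg (v 2))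
    refine hne v hv ?_
    have e1 : a * (b * c * v 0 + l * v 1 + m * v 2) ^ 2 = 0 := by linarith
    have e2 : b * (a * v 1 + n * v 2) ^ 2 = 0 := by linarith
    have e3 : 2 * c * (v 2) ^ 2 = 0 := by linarith
    simp only [mul_eq_zero, ha.ne', hb.ne', hc.ne', pow_eq_zero_iff, two_ne_zero, false_or, ne_eq,
      not_false_eq_true] at e1 e2 e3
    rw [e1, e2, e3]
  have hbdd : ∀ N : M, ∃ B : M, ∀ v : Fin 3 → M, v ⬝ᵥ G.mulVec v ≤ N → ∀ i, |v i| ≤ B := by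
    intro N
    have key : ∀ {d y u : M}, 1 ≤ d → d * y ^ 2 ≤ u → |y| ≤ u := fun {d y u} hd h =>
      (abs_le_sq hM y).trans (le_trans (le_mul_of_one_le_left (sq_nonneg y) hd) h)
    refine ⟨N + (N + |n| * N) + (N + |l| * (N + |n| * N) + |m| * N), fun v hv => ?_⟩
    rw [hQ] at hv
    have h1 := mul_nonneg ha.le (sq_nonneg (b * c * v 0 + l * v 1 + m * v 2))
    have h2 := mul_nonneg hb.le (sq_nonneg (a * v 1 + n * v 2))
    have h3 := mul_nonneg (mul_pos two_pos hc).le (sq_nonneg (v 2))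
    have k3 : |v 2| ≤ N := key (d := 2 * c) (by linarith) (by linarith)
    have k2 : |a * v 1 + n * v 2| ≤ N := key hb1 (by linarith)
    have k1 : |b * c * v 0 + l * v 1 + m * v 2| ≤ N := key ha1 (by linarith)
    have hN : 0 ≤ N := (abs_nonneg _).trans k3
    have hn : |n * v 2| ≤ |n| * N := by rw [abs_mul]; gcongr
    have hm : |m * v 2| ≤ |m| * N := by rw [abs_mul]; gcongr
    have j1 : |v 1| ≤ N + |n| * N := by
      refine (abs_le_abs_mul_self ha1).trans ?_
      calc |a * v 1| = |(a * v 1 + n * v 2) - n * v 2| := by ring_nf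
        _ ≤ |a * v 1 + n * v 2| + |n * v 2| := abs_sub _ _
        _ ≤ _ := add_le_add k2 hn
    have hl : |l * v 1| ≤ |l| * (N + |n| * N) := by rw [abs_mul]; gcongr
    have j0 : |v 0| ≤ N + |l| * (N + |n| * N) + |m| * N := by
      refine (abs_le_abs_mul_self (a := b * c) (one_le_of_pos hM hbc)).trans ?_
      calc |b * c * v 0| = |((b * c * v 0 + l * v 1 + m * v 2) - l * v 1) - m * v 2| := by ring_nf
        _ ≤ |b * c * v 0 + l * v 1 + m * v 2| + |l * v 1| + |m * v 2| :=
          (abs_sub _ _).trans (add_le_add_left (abs_sub _ _) _)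
        _ ≤ _ := add_le_add (add_le_add k1 hl) hm
    have p1 : 0 ≤ |n| * N := by positivity
    have p2 : 0 ≤ |l| * (N + |n| * N) := by positivity
    have p3 : 0 ≤ |m| * N := by positivity
    intro i
    fin_cases i
    · change |v 0| ≤ _
      linarith
    · change |v 1| ≤ _
      linarith
    · change |v 2| ≤ _
      linarith
  obtain ⟨v, hv, hlt⟩ := exists_value_pow_three_lt hM G hG hpos hbdd
  refine ⟨v 0, v 1, v 2, hne v hv, ?_⟩
  rw [hdet, hQ] at hlt
  exact lt_of_pow_lt_pow_left₀ 3 (by positivity) hlt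

/-- With `w ^ 2 ≡ -a b` modulo `m`, the quotient `s ≡ w / a` satisfies `a s ^ 2 ≡ -b`. -/
theorem exists_dvd_mul_sq_add {a b m : M} (hbm : IsCoprime a m)
    (h : IsSquareMod (-(a * b)) m) : ∃ s : M, m ∣ a * s ^ 2 + b := by
  obtain ⟨w, k, hk⟩ := h
  obtain ⟨u, v, huv⟩ := hbm
  refine ⟨u * w, -a * u ^ 2 * k + b * v * (1 + a * u), ?_⟩
  linear_combination (-a * u ^ 2) * hk - b * (1 + a * u) * huv

theorem exists_dvd_sub_dvd_sub {m n : M} (h : IsCoprime m n) (u v : M) :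
    ∃ x, m ∣ x - u ∧ n ∣ x - v := by
  obtain ⟨p, q, hpq⟩ := h
  exact ⟨u * (q * n) + v * (p * m), ⟨p * (v - u), by linear_combination u * hpq⟩,
    ⟨q * (u - v), by linear_combination v * hpq⟩⟩

/-- The case of Legendre's theorem in which the signs of the coefficients are known. -/
theorem exists_zero_of_pos (hM : {x : M // 0 ≤ x} ⊨ IDelta0) {a b c : M} (ha : 0 < a)
    (hb : 0 < b) (hc : c < 0) (hab : IsCoprime a b) (hbc : IsCoprime b c) (hac : IsCoprime a c)
    (h1 : IsSquareMod (-(a * b)) c) (h2 : IsSquareMod (-(b * c)) a)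
    (h3 : IsSquareMod (-(a * c)) b) :
    ∃ x y z : M, (x, y, z) ≠ (0, 0, 0) ∧ a * x ^ 2 + b * y ^ 2 + c * z ^ 2 = 0 := by
  obtain ⟨k, hk⟩ := exists_dvd_mul_sq_add hac h1
  obtain ⟨s, hs⟩ := exists_dvd_mul_sq_add hab.symm h2
  obtain ⟨t, ht⟩ := exists_dvd_mul_sq_add hab h3
  obtain ⟨l, ⟨l₁, hl₁⟩, ⟨l₂, hl₂⟩⟩ := exists_dvd_sub_dvd_sub hbc 0 (k * a)
  obtain ⟨m, ⟨m₁, hm₁⟩, ⟨m₂, hm₂⟩⟩ := exists_dvd_sub_dvd_sub hbc t (k * s)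
  obtain ⟨X, Y, Z, hne, hlt⟩ := exists_lattice_value_lt hM ha hb (neg_pos.2 hc) l m s
  set x := b * -c * X + l * Y + m * Z with hx
  set y := a * Y + s * Z with hy
  -- Modulo `a`, `b`, `c` the lattice is given by `y ≡ s z`, `x ≡ t z`, `x ≡ k y` respectively.
  have da : a ∣ a * x ^ 2 + b * y ^ 2 + c * Z ^ 2 := by
    obtain ⟨s', hs'⟩ := hs
    refine ⟨x ^ 2 + b * Y * (y + s * Z) + s' * Z ^ 2, ?_⟩
    linear_combination Z ^ 2 * hs' + b * (y + s * Z) * hy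
  have db : b ∣ a * x ^ 2 + b * y ^ 2 + c * Z ^ 2 := by
    obtain ⟨t', ht'⟩ := ht
    refine ⟨a * (-c * X + l₁ * Y + m₁ * Z) * (x + t * Z) + y ^ 2 + t' * Z ^ 2, ?_⟩
    linear_combination Z ^ 2 * ht' + a * (x + t * Z) * (hx + Y * hl₁ + Z * hm₁)
  have dc : c ∣ a * x ^ 2 + b * y ^ 2 + c * Z ^ 2 := by
    obtain ⟨k', hk'⟩ := hk
    refine ⟨a * (-b * X + l₂ * Y + m₂ * Z) * (x + k * y) + k' * y ^ 2 + Z ^ 2, ?_⟩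
    linear_combination y ^ 2 * hk' + a * (x + k * y) * (hx + Y * hl₂ + Z * hm₂ - k * hy)
  obtain ⟨q, hq⟩ := (hac.mul_left hbc).mul_dvd (hab.mul_dvd da db) dc
  have hd : 0 < -(a * b * c) := by
    have := mul_pos (mul_pos ha hb) (neg_pos.2 hc)
    linarith
  have e1 := mul_nonneg ha.le (sq_nonneg x)
  have e2 := mul_nonneg hb.le (sq_nonneg y)
  have e3 := mul_nonneg (neg_pos.2 hc).le (sq_nonneg Z)
  -- The value at `(x, y, Z)` is a multiple of `a b c` strictly between `a b c` and `-2 a b c`.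
  have hq1 : q < 1 := by
    by_contra! h
    nlinarith [mul_nonneg hd.le (sub_nonneg.2 h)]
  have hq2 : -2 < q := by
    by_contra! h
    nlinarith [mul_nonneg hd.le (by linarith : 0 ≤ -2 - q)]
  rcases (show q ≤ 0 by linarith [one_le_of_pos hM (sub_pos.2 hq1)]).eq_or_lt with rfl | hq0
  · exact ⟨x, y, Z, hne, by rw [hq, mul_zero]⟩
  · have hq3 : q = -1 := by
      linarith [one_le_of_pos hM (neg_pos.2 hq0), one_le_of_pos hM (neg_lt_iff_pos_add.1 hq2)]
    rw [hq3] at hq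
    refine ⟨x * Z + b * y, y * Z - a * x, Z ^ 2 + a * b, fun h => ?_, ?_⟩
    · simp only [Prod.mk.injEq] at h
      nlinarith [h.2.2, sq_nonneg Z, mul_pos ha hb]
    · linear_combination (Z ^ 2 + a * b) * hq

theorem isSquareMod_neg {R : Type*} [CommRing R] {u v : R} :
    IsSquareMod u (-v) ↔ IsSquareMod u v := by
  simp [IsSquareMod]

/-- Sufficiency of the conditions of Legendre's theorem, up to the order of the coefficients and
their signs. -/
theorem exists_zero_of_signs (hM : {x : M // 0 ≤ x} ⊨ IDelta0) {a b c : M} (ha : a ≠ 0)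
    (hb : b ≠ 0) (hc : c ≠ 0) (hsign : ¬ (0 < a ∧ 0 < b ∧ 0 < c) ∧ ¬ (a < 0 ∧ b < 0 ∧ c < 0))
    (hab : IsCoprime a b) (hbc : IsCoprime b c) (hac : IsCoprime a c)
    (h1 : IsSquareMod (-(a * b)) c) (h2 : IsSquareMod (-(b * c)) a)
    (h3 : IsSquareMod (-(a * c)) b) :
    ∃ x y z : M, (x, y, z) ≠ (0, 0, 0) ∧ a * x ^ 2 + b * y ^ 2 + c * z ^ 2 = 0 := by
  have key : ∀ {a b c : M}, (0 < a ∧ 0 < b ∧ c < 0) ∨ (a < 0 ∧ b < 0 ∧ 0 < c) → IsCoprime a b →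
      IsCoprime b c → IsCoprime a c → IsSquareMod (-(a * b)) c → IsSquareMod (-(b * c)) a →
      IsSquareMod (-(a * c)) b →
      ∃ x y z : M, (x, y, z) ≠ (0, 0, 0) ∧ a * x ^ 2 + b * y ^ 2 + c * z ^ 2 = 0 := by
    rintro a b c (⟨ha, hb, hc⟩ | ⟨ha, hb, hc⟩) hab hbc hac h1 h2 h3
    · exact exists_zero_of_pos hM ha hb hc hab hbc hac h1 h2 h3
    · obtain ⟨x, y, z, hne, h⟩ := exists_zero_of_pos hM (neg_pos.2 ha) (neg_pos.2 hb)
        (neg_lt_zero.2 hc) hab.neg_neg hbc.neg_neg hac.neg_neg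
        (by rwa [neg_mul_neg, isSquareMod_neg]) (by rwa [neg_mul_neg, isSquareMod_neg])
        (by rwa [neg_mul_neg, isSquareMod_neg])
      exact ⟨x, y, z, hne, by linear_combination -h⟩
  have h1' : IsSquareMod (-(b * a)) c := by rwa [mul_comm]
  have h2' : IsSquareMod (-(c * b)) a := by rwa [mul_comm]
  have h3' : IsSquareMod (-(c * a)) b := by rwa [mul_comm]
  have hsplit : ((0 < a ∧ 0 < b ∧ c < 0) ∨ (a < 0 ∧ b < 0 ∧ 0 < c)) ∨
      ((0 < b ∧ 0 < c ∧ a < 0) ∨ (b < 0 ∧ c < 0 ∧ 0 < a)) ∨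
      ((0 < a ∧ 0 < c ∧ b < 0) ∨ (a < 0 ∧ c < 0 ∧ 0 < b)) := by
    rcases ha.lt_or_gt with ha | ha <;> rcases hb.lt_or_gt with hb | hb <;>
      rcases hc.lt_or_gt with hc | hc <;> simp_all
  rcases hsplit with h | h | h
  · exact key h hab hbc hac h1 h2 h3
  · obtain ⟨y, z, x, hne, e⟩ := key h hbc hac.symm hab.symm h2 h3' h1'
    refine ⟨x, y, z, fun h => hne ?_, by linear_combination e⟩
    simp only [Prod.mk.injEq] at h ⊢
    exact ⟨h.2.1, h.2.2, h.1⟩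
  · obtain ⟨x, z, y, hne, e⟩ := key h hac hbc.symm hab h3 h2' h1
    refine ⟨x, y, z, fun h => hne ?_, by linear_combination e⟩
    simp only [Prod.mk.injEq] at h ⊢
    exact ⟨h.1, h.2.2, h.2.1⟩

end Legendre

end LArith

theorem theorem2p1 {M : Type*} [CommRing M] [LinearOrder M] [IsStrictOrderedRing M]
    (hM : {x : M // 0 ≤ x} ⊨ LArith.IDelta0Omega1)
    (a b c : M) (ha : a ≠ 0) (hb : b ≠ 0) (hc : c ≠ 0)
    (hsign : ¬ (0 < a ∧ 0 < b ∧ 0 < c) ∧ ¬ (a < 0 ∧ b < 0 ∧ c < 0))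
    (hsa : Squarefree a) (hsb : Squarefree b) (hsc : Squarefree c)
    (hab : IsRelPrime a b) (hbc : IsRelPrime b c) (hac : IsRelPrime a c) :
    (∃ x y z : M, (x, y, z) ≠ (0, 0, 0) ∧ a * x ^ 2 + b * y ^ 2 + c * z ^ 2 = 0) ↔
      (LArith.IsSquareMod (-(a * b)) c ∧ LArith.IsSquareMod (-(b * c)) a ∧
        LArith.IsSquareMod (-(a * c)) b) := by
  have hM' : {x : M // 0 ≤ x} ⊨ LArith.IDelta0 := hM.mono Set.subset_union_left
  have := LArith.isBezout hM'
  constructor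
  · rintro ⟨x, y, z, hne, h⟩
    exact LArith.isSquareMod_of_zero hsa hsb hsc hab.isCoprime hac.isCoprime hne h
  · rintro ⟨h1, h2, h3⟩
    exact LArith.exists_zero_of_signs hM' ha hb hc hsign hab.isCoprime hbc.isCoprime hac.isCoprime
      h1 h2 h3
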